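/- Let $N \ge 2$ be an integer and let $U$ be a random $N\times N$ unitary matrix distributed according to the Haar probability measure on the unitary group $\mathrm{U}(N)$. Then for all $1\le i,j\le N$ the random variable $p_{ij} := |U_{ij}|^2$ has the $\mathrm{Beta}(1,N-1)$ distribution; that is, its law on $\mathbb{R}$ is absolutely continuous with respect to Lebesgue measure, with density $$p \mapsto (N-1)(1-p)^{N-2}\,\mathbf{1}_{0\le p\le 1}.$$ -/

import Mathlib

open MeasureTheory ProbabilityTheory

/-!
A column `x` of a Haar unitary matrix and a standard Gaussian vector `y` of `ℂⁿ` both have unitarily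
invariant laws without mass at `0`, and this already forces `|⟪e, x⟫|² / ‖x‖²` and
`|⟪e, y⟫|² / ‖y‖²` to have the same law for a unit vector `e`. Indeed, the probability under the
product law that `t (‖x‖ ‖y‖)² < |⟪y, x⟫|²` can be computed by freezing either vector, and by
invariance the frozen vector may be replaced by a multiple of `e`.

For the Gaussian vector the squared moduli `X k` of the coordinates are independent exponential
variables of rate `1 / 2`. With `a = t / (1 - t)`, the event `t ∑ k, X k < X j` says that `X j`
exceeds `a ∑ k ≠ j, X k`. Since the exponential tail is an exponential function, its probability is
the moment generating function of `a ∑ k ≠ j, X k` at `-1 / 2`, namely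
`(1 + a)⁻¹ ^ (n - 1) = (1 - t) ^ (n - 1)`: the tail of `Beta(1, n - 1)`.
-/

section RealLaws

theorem ext_of_measure_Ioi_of_nonneg {μ ν : Measure ℝ} [IsProbabilityMeasure μ]
    [IsProbabilityMeasure ν] (hν : ν (Set.Ioi 0) = 1)
    (h : ∀ t, 0 ≤ t → μ (Set.Ioi t) = ν (Set.Ioi t)) : μ = ν := by
  have hμ : μ (Set.Ioi 0) = 1 := (h 0 le_rfl).trans hν
  have h_neg (ρ : Measure ℝ) [IsProbabilityMeasure ρ] (hρ : ρ (Set.Ioi 0) = 1) {t : ℝ}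
      (ht : t < 0) : ρ (Set.Ioi t) = 1 :=
    le_antisymm prob_le_one (hρ ▸ measure_mono (Set.Ioi_subset_Ioi ht.le))
  refine Measure.ext_of_Iic _ _ fun t => ?_
  rw [← Set.compl_Ioi, prob_compl_eq_one_sub measurableSet_Ioi,
    prob_compl_eq_one_sub measurableSet_Ioi]
  rcases lt_or_ge t 0 with ht | ht
  · rw [h_neg μ hμ ht, h_neg ν hν ht]
  · rw [h t ht]

theorem expMeasure_Ioi {r : ℝ} (hr : 0 < r) {t : ℝ} (ht : 0 ≤ t) :
    expMeasure r (Set.Ioi t) = ENNReal.ofReal (Real.exp (-(r * t))) := by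
  have := isProbabilityMeasure_expMeasure hr
  rw [← Set.compl_Iic, ← ofReal_measureReal, probReal_compl_eq_one_sub measurableSet_Iic,
    ← cdf_eq_real, cdf_expMeasure_eq hr, if_pos ht, sub_sub_cancel]

theorem ae_nonneg_expMeasure (r : ℝ) : ∀ᵐ x ∂expMeasure r, 0 ≤ x := by
  refine measure_eq_zero_iff_ae_notMem.1 ?_ |>.mono fun x hx => not_lt.1 hx
  change expMeasure r (Set.Iio 0) = 0
  rw [expMeasure, gammaMeasure, withDensity_apply _ measurableSet_Iio]
  exact lintegral_gammaPDF_of_nonpos le_rfl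

theorem mgf_id_expMeasure {r s : ℝ} (hr : 0 < r) (hs : s < r) :
    mgf id (expMeasure r) s = r / (r - s) := by
  have hrs : 0 < r - s := sub_pos.2 hs
  have h_density (x : ℝ) : exponentialPDF r x * ENNReal.ofReal (Real.exp (s * x))
      = ENNReal.ofReal (r / (r - s)) * exponentialPDF (r - s) x := by
    rw [exponentialPDF_eq, exponentialPDF_eq, ← ENNReal.ofReal_mul' (Real.exp_pos _).le,
      ← ENNReal.ofReal_mul (by positivity)]
    congr 1
    split_ifs
    · rw [mul_assoc, ← Real.exp_add, ← mul_assoc, div_mul_cancel₀ _ hrs.ne']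
      ring_nf
    · simp
  have h_meas (r : ℝ) : Measurable (exponentialPDF r) :=
    (measurable_exponentialPDFReal r).ennreal_ofReal
  rw [mgf, integral_eq_lintegral_of_nonneg_ae (ae_of_all _ fun _ => (Real.exp_pos _).le)
    (by fun_prop)]
  change (∫⁻ x, _ ∂(volume.withDensity (exponentialPDF r))).toReal = _
  rw [lintegral_withDensity_eq_lintegral_mul _ (h_meas r) (by fun_prop)]
  simp only [Pi.mul_apply, id_eq, h_density]
  rw [lintegral_const_mul _ (h_meas _),
    lintegral_exponentialPDF_eq_one hrs, mul_one, ENNReal.toReal_ofReal (by positivity)]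

theorem beta_one_left {b : ℝ} (hb : 0 < b) : beta 1 b = b⁻¹ := by
  have h_Gamma := (Real.Gamma_pos_of_pos hb).ne'
  rw [beta, Real.Gamma_one, one_mul, add_comm, Real.Gamma_add_one hb.ne']
  field_simp

theorem betaPDF_one_left {b : ℝ} (hb : 0 < b) :
    betaPDF 1 b = (Set.Ioo 0 1).indicator fun x => ENNReal.ofReal (b * (1 - x) ^ (b - 1)) := by
  ext x
  by_cases hx : x ∈ Set.Ioo 0 1
  · rw [betaPDF_of_pos_lt_one hx.1 hx.2, Set.indicator_of_mem hx, beta_one_left hb]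
    simp
  · rw [betaPDF_eq, if_neg (show ¬(0 < x ∧ x < 1) from hx), Set.indicator_of_notMem hx,
      ENNReal.ofReal_zero]

theorem betaMeasure_one_left {b : ℝ} (hb : 0 < b) :
    betaMeasure 1 b = volume.withDensity
      ((Set.Icc 0 1).indicator fun x => ENNReal.ofReal (b * (1 - x) ^ (b - 1))) := by
  rw [betaMeasure, betaPDF_one_left hb]
  exact withDensity_congr_ae (indicator_ae_eq_of_ae_eq_set Ioo_ae_eq_Icc)

theorem betaMeasure_one_natCast_sub_one {N : ℕ} (hN : 2 ≤ N) :
    betaMeasure 1 ((N : ℝ) - 1) = volume.withDensity ((Set.Icc 0 1).indicator fun x =>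
      ENNReal.ofReal (((N : ℝ) - 1) * (1 - x) ^ (N - 2))) := by
  have h_exponent : (N : ℝ) - 1 - 1 = (N - 2 : ℕ) := by
    push_cast [hN]
    ring
  rw [betaMeasure_one_left (sub_pos.2 (mod_cast hN)), h_exponent]
  simp only [Real.rpow_natCast]

theorem betaMeasure_one_left_Ioi {b t : ℝ} (hb : 0 < b) (ht : 0 ≤ t) :
    betaMeasure 1 b (Set.Ioi t) = ENNReal.ofReal (1 - t) ^ b := by
  rw [betaMeasure, betaPDF_one_left hb, withDensity_apply _ measurableSet_Ioi,
    setLIntegral_indicator measurableSet_Ioo, Set.inter_comm, Set.Ioi_inter_Ioo, max_eq_left ht]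
  rcases le_or_gt 1 t with ht1 | ht1
  · simp [Set.Ioo_eq_empty_of_le ht1, ENNReal.ofReal_of_nonpos (sub_nonpos.2 ht1), hb]
  have h_int : IntervalIntegrable (fun x : ℝ => b * (1 - x) ^ (b - 1)) volume t 1 := by
    have := (intervalIntegral.intervalIntegrable_rpow' (a := 1 - t) (b := 0)
      (show -1 < b - 1 by linarith)).comp_sub_left 1
    simpa using this.const_mul b
  rw [restrict_Ioo_eq_restrict_Ioc, ← ofReal_integral_eq_lintegral_ofReal h_int.1,
    ← intervalIntegral.integral_of_le ht1.le, intervalIntegral.integral_const_mul,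
    intervalIntegral.integral_comp_sub_left (fun x => x ^ (b - 1)), sub_self,
    integral_rpow (Or.inl (by linarith)), sub_add_cancel, Real.zero_rpow hb.ne', sub_zero,
    mul_div_cancel₀ _ hb.ne', ENNReal.ofReal_rpow_of_nonneg (by linarith) hb.le]
  filter_upwards [ae_restrict_mem measurableSet_Ioc] with x hx
  have : 0 ≤ 1 - x := sub_nonneg.2 hx.2
  positivity

end RealLaws

section Exponential

variable {Ω : Type*} [MeasurableSpace Ω] {P : Measure Ω} {r : ℝ}

theorem measureReal_lt_eq_mgf_of_hasLaw_expMeasure {X Y : Ω → ℝ} (hr : 0 < r)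
    (hX : HasLaw X (expMeasure r) P) (hY : AEMeasurable Y P) (hY_nonneg : ∀ᵐ ω ∂P, 0 ≤ Y ω)
    (hYX : IndepFun Y X P) :
    P.real {ω | Y ω < X ω} = mgf Y P (-r) := by
  have := isProbabilityMeasure_expMeasure hr
  have : IsProbabilityMeasure P := hX.isProbabilityMeasure_iff.2 ‹_›
  have h_joint : HasLaw (fun ω => (Y ω, X ω)) ((P.map Y).prod (expMeasure r)) P :=
    hYX.hasLaw_prod ⟨hY, rfl⟩ hX
  have h_meas : MeasurableSet {p : ℝ × ℝ | p.1 < p.2} :=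
    measurableSet_lt measurable_fst measurable_snd
  rw [mgf, integral_eq_lintegral_of_nonneg_ae (ae_of_all _ fun _ => (Real.exp_pos _).le)
    (by fun_prop), measureReal_def, h_joint.measure_eq h_meas, Measure.prod_apply h_meas,
    lintegral_map' (measurable_measure_prodMk_left h_meas).aemeasurable hY]
  congr 1
  refine lintegral_congr_ae (hY_nonneg.mono fun ω hω => ?_)
  simp only [neg_mul]
  exact expMeasure_Ioi hr hω

variable {ι : Type*} {X : ι → Ω → ℝ}

theorem measureReal_mul_sum_lt_of_hasLaw_expMeasure_of_notMem (hr : 0 < r)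
    (hX : ∀ k, HasLaw (X k) (expMeasure r) P) (hX_indep : iIndepFun X P) {s : Finset ι} {j : ι}
    (hj : j ∉ s) {a : ℝ} (ha : 0 ≤ a) :
    P.real {ω | a * ∑ k ∈ s, X k ω < X j ω} = (1 + a)⁻¹ ^ s.card := by
  have h_aemeas (k : ι) : AEMeasurable (X k) P := (hX k).aemeasurable
  have h_nonneg (k : ι) : ∀ᵐ ω ∂P, 0 ≤ X k ω :=
    ae_of_ae_map (h_aemeas k) ((hX k).map_eq ▸ ae_nonneg_expMeasure r)
  have h_sum_nonneg : ∀ᵐ ω ∂P, 0 ≤ (a • ∑ k ∈ s, X k) ω := by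
    filter_upwards [(Finset.eventually_all s).2 fun k _ => h_nonneg k] with ω hω
    rw [Pi.smul_apply, Finset.sum_apply]
    exact mul_nonneg ha (Finset.sum_nonneg hω)
  have h_indep : IndepFun (a • ∑ k ∈ s, X k) (X j) P :=
    (hX_indep.indepFun_finsetSum_of_notMem₀ h_aemeas hj).comp (measurable_const_mul a)
      measurable_id
  have h_mgf (k : ι) : mgf (X k) P (a * -r) = (1 + a)⁻¹ := by
    rw [← mgf_id_map (h_aemeas k), (hX k).map_eq, mgf_id_expMeasure hr (by nlinarith),
      show r - a * -r = r * (1 + a) by ring, div_mul_cancel_left₀ hr.ne']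
  calc P.real {ω | a * ∑ k ∈ s, X k ω < X j ω}
      = P.real {ω | (a • ∑ k ∈ s, X k) ω < X j ω} := by
        simp only [Pi.smul_apply, Finset.sum_apply, smul_eq_mul]
    _ = mgf (a • ∑ k ∈ s, X k) P (-r) :=
        measureReal_lt_eq_mgf_of_hasLaw_expMeasure hr (hX j)
          ((Finset.aemeasurable_sum s fun k _ => h_aemeas k).const_smul a) h_sum_nonneg h_indep
    _ = ∏ k ∈ s, mgf (X k) P (a * -r) := by rw [mgf_smul_left, hX_indep.mgf_sum₀ h_aemeas]
    _ = (1 + a)⁻¹ ^ s.card := Finset.prod_eq_pow_card fun k _ => h_mgf k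

theorem measureReal_mul_sum_lt_of_hasLaw_expMeasure [Fintype ι] (hr : 0 < r)
    (hX : ∀ k, HasLaw (X k) (expMeasure r) P) (hX_indep : iIndepFun X P) (j : ι) {t : ℝ}
    (ht : 0 ≤ t) (ht1 : t < 1) :
    P.real {ω | t * ∑ k, X k ω < X j ω} = (1 - t) ^ (Fintype.card ι - 1) := by
  classical
  have h1t : 0 < 1 - t := sub_pos.2 ht1
  have h_event (ω : Ω) : t * ∑ k, X k ω < X j ω ↔
      t / (1 - t) * ∑ k ∈ Finset.univ.erase j, X k ω < X j ω := by
    rw [← Finset.add_sum_erase _ _ (Finset.mem_univ j), div_mul_eq_mul_div, div_lt_iff₀ h1t]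
    constructor <;> intro h <;> linarith
  have h_inv : (1 + t / (1 - t))⁻¹ = 1 - t := by
    field_simp
    ring
  simp only [h_event]
  rw [measureReal_mul_sum_lt_of_hasLaw_expMeasure_of_notMem hr hX hX_indep (Finset.notMem_erase j _)
    (div_nonneg ht h1t.le), h_inv, Finset.card_erase_of_mem (Finset.mem_univ j), Finset.card_univ]

end Exponential

section Gaussian

open scoped InnerProductSpace

theorem integral_exp_neg_mul_norm_sq_smul_cexp_inner {E : Type*} [NormedAddCommGroup E]
    [InnerProductSpace ℝ E] [FiniteDimensional ℝ E] [MeasurableSpace E] [BorelSpace E] (t : E) :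
    ∫ x : E, Real.exp (-(1 / 2) * ‖x‖ ^ 2) • Complex.exp (⟪x, t⟫_ℝ * Complex.I) =
      (2 * Real.pi) ^ (Module.finrank ℝ E / 2 : ℝ) • Complex.exp (-‖t‖ ^ 2 / 2) := by
  have h_pi : (Real.pi / (1 / 2) : ℂ) ^ (Module.finrank ℝ E / 2 : ℂ)
      = ((2 * Real.pi) ^ (Module.finrank ℝ E / 2 : ℝ) : ℝ) := by
    rw [Complex.ofReal_cpow (by positivity)]
    push_cast
    ring_nf
  calc ∫ x : E, Real.exp (-(1 / 2) * ‖x‖ ^ 2) • Complex.exp (⟪x, t⟫_ℝ * Complex.I)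
      = ∫ x : E, Complex.exp (-(1 / 2) * ‖x‖ ^ 2 + Complex.I * ⟪t, x⟫_ℝ) := by
        simp [Complex.exp_add, real_inner_comm t, mul_comm Complex.I]
    _ = (2 * Real.pi) ^ (Module.finrank ℝ E / 2 : ℝ) •
        Complex.exp (Complex.I ^ 2 * ‖t‖ ^ 2 / (4 * (1 / 2))) := by
        rw [GaussianFourier.integral_cexp_neg_mul_sq_norm_add (by norm_num), h_pi,
          Complex.real_smul]
    _ = (2 * Real.pi) ^ (Module.finrank ℝ E / 2 : ℝ) • Complex.exp (-‖t‖ ^ 2 / 2) := by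
        rw [Complex.I_sq]
        ring_nf

theorem stdGaussian_eq_withDensity (E : Type*) [NormedAddCommGroup E] [InnerProductSpace ℝ E]
    [FiniteDimensional ℝ E] [MeasurableSpace E] [BorelSpace E] :
    stdGaussian E = volume.withDensity fun x : E => ENNReal.ofReal
      (((2 * Real.pi) ^ (Module.finrank ℝ E / 2 : ℝ))⁻¹ * Real.exp (-(1 / 2) * ‖x‖ ^ 2)) := by
  set c := (2 * Real.pi) ^ (Module.finrank ℝ E / 2 : ℝ)
  have hc : 0 < c := Real.rpow_pos_of_pos Real.two_pi_pos _
  have h_int : Integrable fun x : E => c⁻¹ * Real.exp (-(1 / 2) * ‖x‖ ^ 2) := by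
    refine .const_mul (not_imp_comm.1 integral_undef ?_) c⁻¹
    rw [GaussianFourier.integral_rexp_neg_mul_sq_norm (by norm_num)]
    positivity
  have : IsFiniteMeasure (volume.withDensity fun x : E =>
      ENNReal.ofReal (c⁻¹ * Real.exp (-(1 / 2) * ‖x‖ ^ 2))) :=
    isFiniteMeasure_withDensity_ofReal h_int.2
  have h_toReal (x : E) : (ENNReal.ofReal (c⁻¹ * Real.exp (-(1 / 2) * ‖x‖ ^ 2))).toReal
      = c⁻¹ * Real.exp (-(1 / 2) * ‖x‖ ^ 2) :=
    ENNReal.toReal_ofReal (mul_nonneg (inv_nonneg.2 hc.le) (Real.exp_pos _).le)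
  refine Measure.ext_of_charFun (funext fun t => ?_)
  rw [charFun_stdGaussian, charFun_apply, integral_withDensity_eq_integral_toReal_smul
    (by fun_prop) (ae_of_all _ fun _ => ENNReal.ofReal_lt_top)]
  simp only [h_toReal, mul_smul]
  rw [integral_smul, integral_exp_neg_mul_norm_sq_smul_cexp_inner, inv_smul_smul₀ hc.ne']

theorem integral_fun_norm_sq_complex {F : Type*} [NormedAddCommGroup F] [NormedSpace ℝ F]
    (f : ℝ → F) : ∫ z : ℂ, f (‖z‖ ^ 2) = Real.pi • ∫ x in Set.Ioi 0, f x := by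
  have h_ball : volume.real (Metric.ball (0 : ℂ) 1) = Real.pi := by
    simp [measureReal_def, Complex.volume_ball]
  rw [integral_fun_norm_addHaar volume (fun r => f (r ^ 2)), Complex.finrank_real_complex, h_ball,
    smul_comm, ← integral_comp_rpow_Ioi_of_pos (g := f) two_pos]
  congr 1
  simp only [mul_smul, Real.rpow_two, integral_smul]
  norm_num [ofNat_smul_eq_nsmul]

theorem hasLaw_norm_sq_stdGaussian_complex :
    HasLaw (fun z : ℂ => ‖z‖ ^ 2) (expMeasure (1 / 2)) (stdGaussian ℂ) := by
  have := isProbabilityMeasure_expMeasure (r := 1 / 2) (by norm_num)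
  have := Measure.isProbabilityMeasure_map (μ := stdGaussian ℂ)
    (f := fun z => ‖z‖ ^ 2) (by fun_prop)
  refine ⟨by fun_prop, ext_of_measure_Ioi_of_nonneg ?_ fun t ht => ?_⟩
  · rw [expMeasure_Ioi (by norm_num) le_rfl]
    simp
  have h_density (z : ℂ) : (ENNReal.ofReal (((2 * Real.pi) ^ (Module.finrank ℝ ℂ / 2 : ℝ))⁻¹ *
        Real.exp (-(1 / 2) * ‖z‖ ^ 2))).toReal •
        ((fun z : ℂ => ‖z‖ ^ 2) ⁻¹' Set.Ioi t).indicator 1 z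
      = (Set.Ioi t).indicator (fun x => (2 * Real.pi)⁻¹ * Real.exp (-1 / 2 * x)) (‖z‖ ^ 2) := by
    rw [ENNReal.toReal_ofReal (by positivity)]
    by_cases hz : t < ‖z‖ ^ 2 <;> simp [hz, neg_div]
  rw [Measure.map_apply (by fun_prop) measurableSet_Ioi, expMeasure_Ioi (by norm_num) ht,
    ← ofReal_measureReal, ← integral_indicator_one (measurableSet_Ioi.preimage (by fun_prop)),
    stdGaussian_eq_withDensity, integral_withDensity_eq_integral_toReal_smul (by fun_prop)
    (ae_of_all _ fun _ => ENNReal.ofReal_lt_top), integral_congr_ae (ae_of_all _ h_density),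
    integral_fun_norm_sq_complex, setIntegral_indicator measurableSet_Ioi, Set.Ioi_inter_Ioi,
    max_eq_right ht, integral_const_mul, integral_exp_mul_Ioi (by norm_num)]
  congr 1
  simp only [smul_eq_mul]
  field_simp

variable {ι : Type*} [Fintype ι] (F : ι → Type*) [∀ k, NormedAddCommGroup (F k)]
  [∀ k, InnerProductSpace ℝ (F k)] [∀ k, FiniteDimensional ℝ (F k)] [∀ k, MeasurableSpace (F k)]
  [∀ k, BorelSpace (F k)]

theorem map_toLp_pi_stdGaussian :
    (Measure.pi fun k => stdGaussian (F k)).map (WithLp.toLp 2) = stdGaussian (PiLp 2 F) := by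
  refine Measure.ext_of_charFun (funext fun t => ?_)
  simp only [charFun_pi, charFun_stdGaussian, ← Complex.exp_sum, ← Complex.ofReal_pow,
    PiLp.norm_sq_eq_of_L2]
  simp [← Finset.sum_div, ← Finset.sum_neg_distrib]

theorem hasLaw_eval_stdGaussian (k : ι) :
    HasLaw (fun w : PiLp 2 F => w k) (stdGaussian (F k)) (stdGaussian (PiLp 2 F)) where
  map_eq := by
    rw [← map_toLp_pi_stdGaussian, Measure.map_map (by fun_prop) (by fun_prop)]
    exact (measurePreserving_eval (fun k => stdGaussian (F k)) k).map_eq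

theorem iIndepFun_eval_stdGaussian :
    iIndepFun (fun k (w : PiLp 2 F) => w k) (stdGaussian (PiLp 2 F)) := by
  rw [iIndepFun_iff_map_fun_eq_pi_map (fun k => (hasLaw_eval_stdGaussian F k).aemeasurable)]
  simp only [(hasLaw_eval_stdGaussian F _).map_eq]
  rw [← map_toLp_pi_stdGaussian, Measure.map_map (by fun_prop) (by fun_prop)]
  exact Measure.map_id

theorem stdGaussian_measureReal_mul_norm_sq_lt (j : ι) {t : ℝ}
    (ht : 0 ≤ t) (ht1 : t < 1) :
    (stdGaussian (EuclideanSpace ℂ ι)).real {w | t * ‖w‖ ^ 2 < ‖w j‖ ^ 2}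
      = (1 - t) ^ (Fintype.card ι - 1) := by
  have h_law (k : ι) : HasLaw (fun w : EuclideanSpace ℂ ι => ‖w k‖ ^ 2) (expMeasure (1 / 2))
      (stdGaussian (EuclideanSpace ℂ ι)) :=
    hasLaw_norm_sq_stdGaussian_complex.comp (hasLaw_eval_stdGaussian (fun _ => ℂ) k)
  have h_indep : iIndepFun (fun k (w : EuclideanSpace ℂ ι) => ‖w k‖ ^ 2)
      (stdGaussian (EuclideanSpace ℂ ι)) :=
    (iIndepFun_eval_stdGaussian fun _ : ι => ℂ).comp (fun _ z => ‖z‖ ^ 2) fun _ => by fun_prop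
  simp only [EuclideanSpace.norm_sq_eq]
  exact measureReal_mul_sum_lt_of_hasLaw_expMeasure (by norm_num) h_law h_indep j ht ht1

theorem ae_ne_zero_stdGaussian (E : Type*) [NormedAddCommGroup E] [InnerProductSpace ℝ E]
    [FiniteDimensional ℝ E] [MeasurableSpace E] [BorelSpace E] [Nontrivial E] :
    ∀ᵐ x ∂stdGaussian E, x ≠ 0 := by
  rw [stdGaussian_eq_withDensity]
  exact (withDensity_absolutelyContinuous _ _).ae_le (Measure.ae_ne volume 0)

end Gaussian

/-- Invariance of a measure on a Hilbert space under the unitary group of the space (the orthogonal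
group when `𝕜 = ℝ`). -/
def IsUnitarilyInvariant (𝕜 : Type*) {E : Type*} [RCLike 𝕜] [NormedAddCommGroup E]
    [InnerProductSpace 𝕜 E] [MeasurableSpace E] (μ : Measure E) : Prop :=
  ∀ V : E ≃ₗᵢ[𝕜] E, MeasurePreserving V μ μ

section UnitarilyInvariant

variable {𝕜 E : Type*} [RCLike 𝕜] [NormedAddCommGroup E] [InnerProductSpace 𝕜 E]

open scoped InnerProductSpace

theorem exists_linearIsometryEquiv_apply_eq [FiniteDimensional 𝕜 E] {x y : E} (h : ‖x‖ = ‖y‖) :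
    ∃ V : E ≃ₗᵢ[𝕜] E, V x = y := by
  rcases eq_or_ne x 0 with rfl | hx
  · exact ⟨.refl 𝕜 E, by simpa [eq_comm] using h⟩
  have hy : y ≠ 0 := norm_ne_zero_iff.1 (h ▸ norm_ne_zero_iff.2 hx)
  let e {z : E} (hz : z ≠ 0) : 𝕜 ≃ₗᵢ[𝕜] Submodule.span 𝕜 {(‖z‖ : 𝕜)⁻¹ • z} :=
    .toSpanUnitSingleton _ (norm_smul_inv_norm hz)
  have he {z : E} (hz : z ≠ 0) : (e hz ‖z‖ : E) = z := by simp [e, smul_smul, hz]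
  let L := (Submodule.subtypeₗᵢ _).comp ((e hx).symm.trans (e hy)).toLinearIsometry
  refine ⟨L.extend.toLinearIsometryEquiv rfl, ?_⟩
  calc L.extend x = L (e hx ‖x‖) := by rw [← L.extend_apply, he hx]
    _ = e hy ‖x‖ := by simp [L]
    _ = y := by rw [h, he hy]

variable [MeasurableSpace E] [BorelSpace E] {μ ν : Measure E}

theorem IsUnitarilyInvariant.measure_mul_norm_sq_lt_norm_inner_sq [FiniteDimensional 𝕜 E]
    (hμ : IsUnitarilyInvariant 𝕜 μ) {e y : E} (he : ‖e‖ = 1) (hy : y ≠ 0) (t : ℝ) :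
    μ {x | t * (‖x‖ * ‖y‖) ^ 2 < ‖⟪y, x⟫_𝕜‖ ^ 2} = μ {x | t * ‖x‖ ^ 2 < ‖⟪e, x⟫_𝕜‖ ^ 2} := by
  have hy_sq : 0 < ‖y‖ ^ 2 := pow_pos (norm_pos_iff.2 hy) 2
  obtain ⟨V, hV⟩ : ∃ V : E ≃ₗᵢ[𝕜] E, V ((‖y‖ : 𝕜) • e) = y :=
    exists_linearIsometryEquiv_apply_eq (by simp [norm_smul, he])
  have h_meas : MeasurableSet {x | t * (‖x‖ * ‖y‖) ^ 2 < ‖⟪y, x⟫_𝕜‖ ^ 2} :=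
    (isOpen_lt (by fun_prop) (by fun_prop)).measurableSet
  have h_inner (x : E) : ‖⟪y, V x⟫_𝕜‖ = ‖y‖ * ‖⟪e, x⟫_𝕜‖ := by
    conv_lhs => rw [← hV, V.inner_map_map, inner_smul_left]
    simp
  rw [← (hμ V).measure_preimage h_meas.nullMeasurableSet]
  congr 1
  ext x
  rw [Set.mem_preimage, Set.mem_ofPred_eq, Set.mem_ofPred_eq, V.norm_map, h_inner,
    ← mul_lt_mul_iff_right₀ (b := t * ‖x‖ ^ 2) hy_sq]
  ring_nf

theorem IsUnitarilyInvariant.measure_mul_norm_sq_lt_congr [FiniteDimensional 𝕜 E]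
    [IsProbabilityMeasure μ] [IsProbabilityMeasure ν] (hμ : IsUnitarilyInvariant 𝕜 μ)
    (hν : IsUnitarilyInvariant 𝕜 ν) (hμ₀ : ∀ᵐ x ∂μ, x ≠ 0) (hν₀ : ∀ᵐ x ∂ν, x ≠ 0) {e : E}
    (he : ‖e‖ = 1) (t : ℝ) :
    μ {x | t * ‖x‖ ^ 2 < ‖⟪e, x⟫_𝕜‖ ^ 2} = ν {x | t * ‖x‖ ^ 2 < ‖⟪e, x⟫_𝕜‖ ^ 2} := by
  have := FiniteDimensional.proper_rclike 𝕜 E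
  let S : Set (E × E) := {p | t * (‖p.1‖ * ‖p.2‖) ^ 2 < ‖⟪p.2, p.1⟫_𝕜‖ ^ 2}
  have hS : MeasurableSet S := (isOpen_lt (by fun_prop) (by fun_prop)).measurableSet
  have h_fst : ∀ᵐ y ∂ν, μ ((fun x => (x, y)) ⁻¹' S) = μ {x | t * ‖x‖ ^ 2 < ‖⟪e, x⟫_𝕜‖ ^ 2} :=
    hν₀.mono fun y hy => hμ.measure_mul_norm_sq_lt_norm_inner_sq he hy t
  have h_snd : ∀ᵐ x ∂μ, ν (Prod.mk x ⁻¹' S) = ν {x | t * ‖x‖ ^ 2 < ‖⟪e, x⟫_𝕜‖ ^ 2} :=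
    hμ₀.mono fun x hx => by
      rw [← hν.measure_mul_norm_sq_lt_norm_inner_sq he hx t]
      simp only [S, Set.preimage_ofPred_eq, norm_inner_symm x, mul_comm]
  calc μ {x | t * ‖x‖ ^ 2 < ‖⟪e, x⟫_𝕜‖ ^ 2}
      = ∫⁻ y, μ ((fun x => (x, y)) ⁻¹' S) ∂ν := by
        rw [lintegral_congr_ae h_fst, lintegral_const, measure_univ, mul_one]
    _ = (μ.prod ν) S := (Measure.prod_apply_symm hS).symm
    _ = ∫⁻ x, ν (Prod.mk x ⁻¹' S) ∂μ := Measure.prod_apply hS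
    _ = ν {x | t * ‖x‖ ^ 2 < ‖⟪e, x⟫_𝕜‖ ^ 2} := by
        rw [lintegral_congr_ae h_snd, lintegral_const, measure_univ, mul_one]

end UnitarilyInvariant

section UnitaryGroup

theorem isUnitarilyInvariant_stdGaussian (𝕜 n : Type*) [RCLike 𝕜] [Fintype n] :
    IsUnitarilyInvariant 𝕜 (stdGaussian (EuclideanSpace 𝕜 n)) := by
  intro V
  let f : EuclideanSpace 𝕜 n ≃ₗᵢ[ℝ] EuclideanSpace 𝕜 n :=
    { V.toLinearEquiv.restrictScalars ℝ with norm_map' := V.norm_map }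
  exact ⟨V.continuous.measurable, stdGaussian_map f⟩

variable {𝕜 n : Type*} [RCLike 𝕜] [Fintype n] [DecidableEq n]

theorem exists_unitaryGroup_toLp_mulVec_eq (V : EuclideanSpace 𝕜 n ≃ₗᵢ[𝕜] EuclideanSpace 𝕜 n) :
    ∃ W : Matrix.unitaryGroup n 𝕜, ∀ v, WithLp.toLp 2 ((W : Matrix n n 𝕜).mulVec v)
      = V (WithLp.toLp 2 v) := by
  let toMatrix := (Matrix.toEuclideanCLM (n := n) (𝕜 := 𝕜)).symm
  refine ⟨⟨toMatrix V, Unitary.map_mem toMatrix (Unitary.linearIsometryEquiv.symm V).2⟩,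
    fun v => ?_⟩
  rw [← Matrix.toEuclideanCLM_toLp, StarAlgEquiv.apply_symm_apply]
  rfl

/-- The `j`-th column of a unitary matrix as a vector of the Hilbert space `EuclideanSpace 𝕜 n`; it
transports invariant measures on the unitary group to unitarily invariant measures on the space. -/
def unitaryColumn (j : n) (U : Matrix.unitaryGroup n 𝕜) : EuclideanSpace 𝕜 n :=
  WithLp.toLp 2 ((U : Matrix n n 𝕜).col j)

theorem unitaryColumn_apply (i j : n) (U : Matrix.unitaryGroup n 𝕜) :
    unitaryColumn j U i = (U : Matrix n n 𝕜) i j :=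
  rfl

theorem norm_unitaryColumn (j : n) (U : Matrix.unitaryGroup n 𝕜) : ‖unitaryColumn j U‖ = 1 := by
  have h_entry : ∑ i, star ((U : Matrix n n 𝕜) i j) * (U : Matrix n n 𝕜) i j = 1 := by
    simpa [Matrix.mul_apply] using congr_fun₂ (Matrix.mem_unitaryGroup_iff'.1 U.2) j j
  have h_sq : ‖unitaryColumn j U‖ ^ 2 = 1 := by
    rw [EuclideanSpace.norm_sq_eq]
    simp only [unitaryColumn_apply]
    simp only [RCLike.star_def, RCLike.conj_mul] at h_entry
    exact_mod_cast h_entry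
  exact (pow_eq_one_iff_of_nonneg (norm_nonneg _) two_ne_zero).1 h_sq

theorem exists_unitaryColumn_mul_eq (V : EuclideanSpace 𝕜 n ≃ₗᵢ[𝕜] EuclideanSpace 𝕜 n) :
    ∃ W : Matrix.unitaryGroup n 𝕜, ∀ j U, unitaryColumn j (W * U) = V (unitaryColumn j U) :=
  (exists_unitaryGroup_toLp_mulVec_eq V).imp fun _ hW _ _ => hW _

variable [MeasurableSpace (Matrix.unitaryGroup n 𝕜)] [BorelSpace (Matrix.unitaryGroup n 𝕜)]
  {μ : Measure (Matrix.unitaryGroup n 𝕜)}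

theorem measurable_unitaryColumn (j : n) :
    Measurable (unitaryColumn j : Matrix.unitaryGroup n 𝕜 → EuclideanSpace 𝕜 n) := by
  refine Continuous.measurable ?_
  unfold unitaryColumn Matrix.col
  fun_prop

theorem isUnitarilyInvariant_map_unitaryColumn [μ.IsMulLeftInvariant] (j : n) :
    IsUnitarilyInvariant 𝕜 (μ.map (unitaryColumn j)) := by
  intro V
  obtain ⟨W, hW⟩ := exists_unitaryColumn_mul_eq V
  refine ⟨V.continuous.measurable, ?_⟩
  calc (μ.map (unitaryColumn j)).map V
      = μ.map fun U => unitaryColumn j (W * U) := by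
        rw [Measure.map_map V.continuous.measurable (measurable_unitaryColumn j)]
        simp only [Function.comp_def, hW]
    _ = (μ.map (W * ·)).map (unitaryColumn j) :=
        (Measure.map_map (measurable_unitaryColumn j) (by fun_prop)).symm
    _ = μ.map (unitaryColumn j) := by rw [map_mul_left_eq_self]

theorem ae_ne_zero_map_unitaryColumn (j : n) : ∀ᵐ w ∂μ.map (unitaryColumn j), w ≠ 0 := by
  refine (ae_map_iff (measurable_unitaryColumn j).aemeasurable
    (measurableSet_singleton 0).compl).2 (ae_of_all _ fun U => ?_)
  exact norm_ne_zero_iff.1 (norm_unitaryColumn j U ▸ one_ne_zero)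

end UnitaryGroup

section HaarEntry

open scoped InnerProductSpace

variable {n : Type*} [Fintype n] [DecidableEq n] [MeasurableSpace (Matrix.unitaryGroup n ℂ)]
  [BorelSpace (Matrix.unitaryGroup n ℂ)] (μ : Measure (Matrix.unitaryGroup n ℂ))
  [μ.IsMulLeftInvariant] [IsProbabilityMeasure μ]

theorem unitaryGroup_measure_lt_norm_sq_apply_of_lt_one (i j : n) {t : ℝ} (ht : 0 ≤ t)
    (ht1 : t < 1) :
    μ {U | t < ‖(U : Matrix n n ℂ) i j‖ ^ 2} =
      ENNReal.ofReal ((1 - t) ^ (Fintype.card n - 1)) := by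
  have : Nonempty n := ⟨i⟩
  have := Measure.isProbabilityMeasure_map (μ := μ)
    (measurable_unitaryColumn (𝕜 := ℂ) j).aemeasurable
  let e : EuclideanSpace ℂ n := EuclideanSpace.single i 1
  have h_inner (w : EuclideanSpace ℂ n) : ⟪e, w⟫_ℂ = w i := by
    simp [e, EuclideanSpace.inner_single_left]
  let S : Set (EuclideanSpace ℂ n) := {w | t * ‖w‖ ^ 2 < ‖⟪e, w⟫_ℂ‖ ^ 2}
  have hS : MeasurableSet S := (isOpen_lt (by fun_prop) (by fun_prop)).measurableSet
  calc μ {U | t < ‖(U : Matrix n n ℂ) i j‖ ^ 2}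
      = μ.map (unitaryColumn j) S := by
        rw [Measure.map_apply (measurable_unitaryColumn j) hS]
        simp [S, h_inner, norm_unitaryColumn, unitaryColumn_apply]
    _ = stdGaussian (EuclideanSpace ℂ n) S :=
        (isUnitarilyInvariant_map_unitaryColumn j).measure_mul_norm_sq_lt_congr
          (isUnitarilyInvariant_stdGaussian ℂ n) (ae_ne_zero_map_unitaryColumn j)
          (ae_ne_zero_stdGaussian _) (by simp [e]) t
    _ = ENNReal.ofReal ((1 - t) ^ (Fintype.card n - 1)) := by
        rw [← stdGaussian_measureReal_mul_norm_sq_lt i ht ht1, ofReal_measureReal]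
        simp only [S, h_inner]

variable [Nontrivial n]

theorem unitaryGroup_measure_lt_norm_sq_apply (i j : n) {t : ℝ} (ht : 0 ≤ t) :
    μ {U | t < ‖(U : Matrix n n ℂ) i j‖ ^ 2} =
      ENNReal.ofReal (1 - t) ^ ((Fintype.card n : ℝ) - 1) := by
  have h_card : 1 < Fintype.card n := Fintype.one_lt_card
  rcases lt_or_ge t 1 with ht1 | ht1
  · rw [unitaryGroup_measure_lt_norm_sq_apply_of_lt_one μ i j ht ht1,
      ENNReal.ofReal_pow (sub_nonneg.2 ht1.le), ← ENNReal.rpow_natCast, Nat.cast_pred (by lia)]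
  · have h_entry (U : Matrix.unitaryGroup n ℂ) : ¬t < ‖(U : Matrix n n ℂ) i j‖ ^ 2 :=
      not_lt.2 ((pow_le_one₀ (norm_nonneg _) (entry_norm_bound_of_unitary U.2 i j)).trans ht1)
    rw [ENNReal.ofReal_of_nonpos (sub_nonpos.2 ht1),
      ENNReal.zero_rpow_of_pos (sub_pos.2 (mod_cast h_card))]
    simp [h_entry]

theorem hasLaw_norm_sq_apply_unitaryGroup (i j : n) :
    HasLaw (fun U : Matrix.unitaryGroup n ℂ => ‖(U : Matrix n n ℂ) i j‖ ^ 2)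
      (betaMeasure 1 ((Fintype.card n : ℝ) - 1)) μ := by
  have h_card : 0 < (Fintype.card n : ℝ) - 1 := sub_pos.2 (mod_cast Fintype.one_lt_card)
  have h_meas : Measurable fun U : Matrix.unitaryGroup n ℂ => ‖(U : Matrix n n ℂ) i j‖ ^ 2 :=
    ((continuous_subtype_val.matrix_elem i j).norm.pow 2).measurable
  have := isProbabilityMeasureBeta one_pos h_card
  have := Measure.isProbabilityMeasure_map (μ := μ) h_meas.aemeasurable
  refine ⟨h_meas.aemeasurable, ext_of_measure_Ioi_of_nonneg ?_ fun t ht => ?_⟩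
  · simp [betaMeasure_one_left_Ioi h_card le_rfl]
  · rw [Measure.map_apply h_meas measurableSet_Ioi, betaMeasure_one_left_Ioi h_card ht]
    exact unitaryGroup_measure_lt_norm_sq_apply μ i j ht

end HaarEntry

theorem mainTheorem8_general {n : Type*} [Fintype n] [DecidableEq n] [Nontrivial n]
    [MeasurableSpace (Matrix.unitaryGroup n ℂ)] [BorelSpace (Matrix.unitaryGroup n ℂ)]
    (μ : Measure (Matrix.unitaryGroup n ℂ)) [μ.IsMulLeftInvariant] [IsProbabilityMeasure μ]
    {Ω : Type*} [MeasurableSpace Ω] (P : Measure Ω)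
    (U : Ω → Matrix.unitaryGroup n ℂ) (hU : HasLaw U μ P) (i j : n) :
    HasLaw (fun ω => ‖(U ω : Matrix n n ℂ) i j‖ ^ 2)
      (betaMeasure 1 ((Fintype.card n : ℝ) - 1)) P ∧
    HasLaw (fun ω => ‖(U ω : Matrix n n ℂ) i j‖ ^ 2)
      (volume.withDensity fun p : ℝ => (Set.Icc (0 : ℝ) 1).indicator
        (fun p => ENNReal.ofReal
          (((Fintype.card n : ℝ) - 1) * (1 - p) ^ (Fintype.card n - 2))) p) P := by
  have h_law := (hasLaw_norm_sq_apply_unitaryGroup μ i j).fun_comp hU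
  refine ⟨h_law, ?_⟩
  rwa [betaMeasure_one_natCast_sub_one Fintype.one_lt_card] at h_law

theorem mainTheorem8 {N : ℕ} (hN : 2 ≤ N)
    [MeasurableSpace (Matrix.unitaryGroup (Fin N) ℂ)]
    [BorelSpace (Matrix.unitaryGroup (Fin N) ℂ)]
    (μ : Measure (Matrix.unitaryGroup (Fin N) ℂ)) [μ.IsHaarMeasure] [IsProbabilityMeasure μ]
    {Ω : Type*} [MeasurableSpace Ω] (P : Measure Ω)
    (U : Ω → Matrix.unitaryGroup (Fin N) ℂ) (hU : HasLaw U μ P)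
    (i j : Fin N) :
    HasLaw (fun ω => ‖(U ω : Matrix (Fin N) (Fin N) ℂ) i j‖ ^ 2) (betaMeasure 1 ((N : ℝ) - 1)) P ∧
    HasLaw (fun ω => ‖(U ω : Matrix (Fin N) (Fin N) ℂ) i j‖ ^ 2)
      (volume.withDensity fun p : ℝ =>
        (Set.Icc (0 : ℝ) 1).indicator
          (fun p => ENNReal.ofReal (((N : ℝ) - 1) * (1 - p) ^ (N - 2))) p) P := by
  have : Nontrivial (Fin N) := Fin.nontrivial_iff_two_le.2 hN
  simpa only [Fintype.card_fin] using mainTheorem8_general μ P U hU i j
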